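/- All rings are commutative with identity. For a ring $A$, let $K$ be its total quotient ring, that is, the localization of $A$ at the set of its non-zero-divisors. An overring of $A$ is a ring $B$ with $A\subseteq B\subseteq K$. The ring $A$ is called perinormal if every overring $B$ of $A$ such that the extension $A\subseteq B$ satisfies going down is flat as an $A$-module. Let $A$ be a reduced Noetherian ring and let $A'$ be the integral closure of $A$ in its total quotient ring. Then $A'$ is perinormal. -/

import Mathlib

/-- An overring of a commutative ring `A` is a ring between `A` and its total quotient ring,
i.e. an `A`-subalgebra of `FractionRing A` (the localization of `A` at its non-zero-divisors).
The ring `A` is perinormal if every overring `B` of `A` such that `A ⊆ B` satisfies going down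
is flat as an `A`-module. -/
def IsPerinormal (A : Type*) [CommRing A] : Prop :=
  ∀ B : Subalgebra A (FractionRing A), Algebra.HasGoingDown A B → Module.Flat A B

/-!
Let `R` be the integral closure of the Noetherian ring `A` in `K`, and let `B` be an overring of
`R`. For `b ∈ B` write `(R : b)` for the ideal of all `r ∈ R` with `r b ∈ R`. If these ideals
generate the unit ideal of `B`, then linear relations over `R` can be cleared of denominators, and
`B` is flat. If `(R : b)` lies in a prime of `B` instead, going down produces a prime `Q` of `B`
lying over a minimal prime `q` of `(R : b)`, and this is impossible.

To see this, put `P = Q ∩ A`. Elements of `P` are nilpotent modulo `(R : b)` locally at `q`, so up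
to a factor outside `q`, the element `b` lies in the ideal transform of `R` with respect to `P`;
localizing, `P` is maximal. Only finitely many elements of `R` are involved: there is a finite
`A`-algebra `D ⊆ R` whose ideal transform contains `b`. Let `C` be the integral part of that
transform. As in the Krull-Akizuki theorem, `C / yC` is a finite `A`-module for each
non-zero-divisor `y ∈ P`. So `n = Q ∩ C` is finitely generated, and being minimal over `(C : b)` it
has the form `(C : c)` with `c = d b`. Now `c n ⊆ n`, so `c` is integral by the determinant trick,
and `c` lies in the transform because `P c ⊆ C`. Hence `c ∈ C`, contradicting `n ≠ C`.
-/

section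

open Pointwise

variable {A M : Type*} [CommRing A] [AddCommGroup M] [Module A M]

theorem isArtinian_of_forall_exists_pow_smul_eq_zero [IsNoetherianRing A] [Module.Finite A M]
    {P : Ideal A} [P.IsMaximal] (hP : ∀ p ∈ P, ∀ x : M, ∃ k : ℕ, p ^ k • x = 0) :
    IsArtinian A M := by
  let I := Module.annihilator A M
  have : Ring.KrullDimLE 0 (A ⧸ I) := Ring.krullDimLE_zero_iff.mpr fun J hJ =>
    Ideal.isMaximal_of_isIntegral_of_isMaximal_comap (R := A) J <| by
      have hJA : (J.comap (algebraMap A (A ⧸ I))).IsPrime := hJ.comap _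
      have hsupp : ⟨_, hJA⟩ ∈ Module.support A M := by
        rw [Module.support_eq_zeroLocus]
        exact fun a ha => J.mem_comap.mpr <|
          (Ideal.Quotient.eq_zero_iff_mem.mpr ha : algebraMap A (A ⧸ I) a = 0) ▸ J.zero_mem
      obtain ⟨x, hx⟩ := Module.mem_support_iff_exists_annihilator.mp hsupp
      have hPJ : P ≤ J.comap (algebraMap A (A ⧸ I)) := fun p hp => by
        obtain ⟨k, hk⟩ := hP p hp x
        exact hJA.mem_of_pow_mem k (hx (Submodule.mem_annihilator_span_singleton x _ |>.mpr hk))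
      rwa [← Ideal.IsMaximal.eq_of_le ‹_› hJA.ne_top hPJ]
  have : IsArtinianRing (A ⧸ I) := IsNoetherianRing.isArtinianRing_of_krullDimLE_zero
  let _ : Module (A ⧸ I) M := Module.quotientAnnihilator
  have : Module.Finite (A ⧸ I) M := Module.Finite.of_restrictScalars_finite A (A ⧸ I) M
  exact isArtinian_of_surjective_algebraMap (R := A ⧸ I) Ideal.Quotient.mk_surjective

variable {y : A}

theorem isNoetherian_torsionBy_pow [IsNoetherian A (Submodule.torsionBy A M y)] (n : ℕ) :
    IsNoetherian A (Submodule.torsionBy A M (y ^ n)) := by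
  induction n with
  | zero =>
    rw [pow_zero, Submodule.torsionBy_one]
    infer_instance
  | succ n ih =>
    have hy : ∀ t ∈ Submodule.torsionBy A M (y ^ (n + 1)),
        LinearMap.lsmul A M y t ∈ Submodule.torsionBy A M (y ^ n) := fun t ht => by
      simpa [pow_succ, mul_smul] using ht
    refine isNoetherian_of_range_eq_ker
      (Submodule.inclusion (Submodule.torsionBy_le_torsionBy_of_dvd y (y ^ (n + 1))
        (dvd_pow_self y n.succ_ne_zero)))
      ((LinearMap.lsmul A M y).restrict hy) ?_
    ext t
    simp [Submodule.range_inclusion, LinearMap.mem_ker, Subtype.ext_iff]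

theorem mem_pow_smul_top {n : ℕ} {t : M} :
    t ∈ (y ^ n • ⊤ : Submodule A M) ↔ ∃ w : M, y ^ n • w = t := by
  simp [Submodule.mem_smul_pointwise_iff_exists]

theorem pow_smul_top_antitone : Antitone fun n : ℕ => (y ^ n • ⊤ : Submodule A M) :=
  antitone_nat_of_succ_le fun n => by
    rw [pow_succ, mul_smul]
    exact smul_mono_right _ le_top

theorem exists_pow_smul_top_inf_torsionBy_le [IsArtinian A (Submodule.torsionBy A M y)] :
    ∃ m : ℕ, ∀ n, m ≤ n →
      (y ^ n • ⊤ : Submodule A M) ⊓ Submodule.torsionBy A M y ≤ y ^ (n + 1) • ⊤ := by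
  let trace (n : ℕ) : Submodule A (Submodule.torsionBy A M y) :=
    (y ^ n • ⊤ : Submodule A M).comap (Submodule.torsionBy A M y).subtype
  obtain ⟨m, hm⟩ := IsArtinian.monotone_stabilizes
    (⟨trace, fun _ _ hij => Submodule.comap_mono (pow_smul_top_antitone hij)⟩ :
      ℕ →o (Submodule A (Submodule.torsionBy A M y))ᵒᵈ)
  refine ⟨m, fun n hn t ht => ?_⟩
  have heq : trace n = trace (n + 1) := (hm n hn).symm.trans (hm (n + 1) (hn.trans n.le_succ))
  exact (SetLike.ext_iff.mp heq ⟨t, ht.2⟩).mp ht.1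

theorem exists_pow_smul_top_eq_succ [IsArtinian A (Submodule.torsionBy A M y)]
    (hM : ∀ t : M, ∃ k : ℕ, y ^ k • t = 0) :
    ∃ m : ℕ, (y ^ m • ⊤ : Submodule A M) = y ^ (m + 1) • ⊤ := by
  obtain ⟨m, hm⟩ := exists_pow_smul_top_inf_torsionBy_le (A := A) (M := M) (y := y)
  refine ⟨m, le_antisymm (fun z hz => ?_) (pow_smul_top_antitone m.le_succ)⟩
  obtain ⟨k, hk⟩ := hM z
  induction k generalizing z with
  | zero => simpa using (by simpa using hk : z = 0) ▸ Submodule.zero_mem _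
  | succ k ih =>
    obtain ⟨v, rfl⟩ := mem_pow_smul_top.mp hz
    obtain ⟨w, hw⟩ := mem_pow_smul_top.mp <| hm (k + m) (Nat.le_add_left m k)
      ⟨mem_pow_smul_top.mpr ⟨v, rfl⟩, by
        change y • y ^ (k + m) • v = 0
        rw [← hk, smul_smul, smul_smul, ← pow_succ', ← pow_add]
        congr 2; omega⟩
    have hmem : y ^ (m + 1) • w ∈ (y ^ (m + 1) • ⊤ : Submodule A M) :=
      mem_pow_smul_top.mpr ⟨w, rfl⟩
    rw [← sub_add_cancel (y ^ m • v) (y ^ (m + 1) • w)]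
    refine add_mem (ih _ (sub_mem hz (pow_smul_top_antitone m.le_succ hmem)) ?_) hmem
    rw [smul_sub, smul_smul, smul_smul, ← pow_add, ← pow_add, ← hw, add_assoc, sub_self]

theorem finite_quotSMulTop_of_torsionBy (hM : ∀ t : M, ∃ k : ℕ, y ^ k • t = 0)
    [IsArtinian A (Submodule.torsionBy A M y)] [IsNoetherian A (Submodule.torsionBy A M y)] :
    Module.Finite A (QuotSMulTop y M) := by
  obtain ⟨m, hm⟩ := exists_pow_smul_top_eq_succ hM
  have := isNoetherian_torsionBy_pow (A := A) (M := M) (y := y) m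
  refine Module.Finite.of_surjective
    ((Submodule.mkQ _).comp (Submodule.torsionBy A M (y ^ m)).subtype) fun x => ?_
  obtain ⟨t, rfl⟩ := Submodule.mkQ_surjective _ x
  obtain ⟨w, hw⟩ := mem_pow_smul_top.mp (hm ▸ mem_pow_smul_top.mpr ⟨t, rfl⟩)
  refine ⟨⟨t - y • w, ?_⟩, ?_⟩
  · rw [Submodule.mem_torsionBy_iff, smul_sub, smul_smul, ← pow_succ, hw, sub_self]
  · exact (Submodule.Quotient.eq _).mpr <| by
      simpa using Submodule.smul_mem_pointwise_smul w y ⊤ trivial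

theorem finite_quotSMulTop_of_forall_exists_pow_smul_mem [IsNoetherianRing A] {P : Ideal A}
    [P.IsMaximal] {D : Submodule A M} (hD : D.FG)
    (hP : ∀ p ∈ P, ∀ z : M, ∃ k : ℕ, p ^ k • z ∈ D) (hyP : y ∈ P) (hy : IsSMulRegular M y) :
    Module.Finite A (QuotSMulTop y M) := by
  have htors : ∀ p ∈ P, ∀ t : M ⧸ D, ∃ k : ℕ, p ^ k • t = 0 := fun p hp t => by
    obtain ⟨z, rfl⟩ := D.mkQ_surjective t
    exact (hP p hp z).imp fun k hk => (Submodule.Quotient.mk_eq_zero D).mpr hk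
  have : Module.Finite A D := Module.Finite.iff_fg.mpr hD
  let N := D.comap (LinearMap.lsmul A M y)
  have : IsNoetherian A N := isNoetherian_of_injective
    ((LinearMap.lsmul A M y).restrict (p := N) (q := D) fun _ hz => hz)
    fun z w hzw => Subtype.ext (hy (congrArg Subtype.val hzw))
  have : IsNoetherian A (Submodule.torsionBy A (M ⧸ D) y) := isNoetherian_of_surjective
    (D.mkQ.restrict fun z (hz : z ∈ N) => (Submodule.Quotient.mk_eq_zero D).mpr hz) <|
    LinearMap.range_eq_top.mpr fun ⟨t, ht⟩ => by
      obtain ⟨z, rfl⟩ := D.mkQ_surjective t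
      exact ⟨⟨z, (Submodule.Quotient.mk_eq_zero D).mp ht⟩, rfl⟩
  have : IsArtinian A (Submodule.torsionBy A (M ⧸ D) y) :=
    isArtinian_of_forall_exists_pow_smul_eq_zero fun p hp t =>
      (htors p hp t).imp fun k hk => Subtype.ext hk
  have := finite_quotSMulTop_of_torsionBy (htors y hyP)
  exact Module.Finite.of_exact
    (QuotSMulTop.map_exact y (LinearMap.exact_subtype_mkQ D) D.mkQ_surjective)
    (QuotSMulTop.map_surjective y D.mkQ_surjective)

theorem finite_quotient_of_forall_exists_pow_smul_mem {B : Type*} [CommRing B] [Algebra A B]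
    [IsNoetherianRing A] {P : Ideal A} [P.IsMaximal] {D : Submodule A B} (hD : D.FG)
    (hP : ∀ p ∈ P, ∀ z : B, ∃ k : ℕ, p ^ k • z ∈ D) (hyP : y ∈ P) (hy : IsSMulRegular B y)
    {I : Ideal B} (hyI : algebraMap A B y ∈ I) : Module.Finite A (B ⧸ I) := by
  have := finite_quotSMulTop_of_forall_exists_pow_smul_mem hD hP hyP hy
  have hle : (y • ⊤ : Submodule A B) ≤ LinearMap.ker (Ideal.Quotient.mkₐ A I).toLinearMap := by
    rintro _ ⟨z, -, rfl⟩
    exact Ideal.Quotient.eq_zero_iff_mem.mpr <| by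
      simpa [Algebra.smul_def] using I.mul_mem_right z hyI
  exact Module.Finite.of_surjective (Submodule.liftQ _ _ hle) fun x => by
    obtain ⟨z, rfl⟩ := Ideal.Quotient.mk_surjective x
    exact ⟨Submodule.Quotient.mk z, rfl⟩

end

section

variable {A B : Type*} [CommRing A] [CommRing B] [Algebra A B]

theorem isIntegral_of_forall_mul_mem {N : Submodule A B} (hN : N.FG) {x y : B} (hyN : y ∈ N)
    (hy : y ∈ nonZeroDivisors B) (hx : ∀ z ∈ N, x * z ∈ N) : IsIntegral A x := by
  have : Module.Finite A N := Module.Finite.iff_fg.mpr hN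
  let φ : Module.End A N := (LinearMap.mulLeft A x).restrict hx
  obtain ⟨p, hp, hpφ⟩ := LinearMap.exists_monic_and_aeval_eq_zero A φ
  have hpow (n : ℕ) : ((φ ^ n) ⟨y, hyN⟩ : B) = x ^ n * y := by
    induction n with
    | zero => simp
    | succ n ih => rw [pow_succ', Module.End.mul_apply, pow_succ', mul_assoc, ← ih]; rfl
  have haeval (q : Polynomial A) :
      (Polynomial.aeval φ q ⟨y, hyN⟩ : B) = Polynomial.aeval x q * y := by
    induction q using Polynomial.induction_on' with
    | add p q hp hq => simp [hp, hq, add_mul]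
    | monomial n a => simp [Polynomial.aeval_monomial, hpow, Algebra.smul_def, mul_assoc]
  exact ⟨p, hp, mul_right_mem_nonZeroDivisors_eq_zero_iff hy |>.mp <| by
    rw [← Polynomial.aeval_def, ← haeval, hpφ]; rfl⟩

theorem fg_of_mem_of_isNoetherianRing_quotient_span {I : Ideal A} {y : A} (hy : y ∈ I)
    [IsNoetherianRing (A ⧸ Ideal.span {y})] : I.FG := by
  refine Ideal.fg_of_fg_map_of_fg_inf_ker_of_surjective
    (f := Ideal.Quotient.mk (Ideal.span {y})) (IsNoetherian.noetherian _) ?_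
    Ideal.Quotient.mk_surjective
  rw [Ideal.mk_ker, inf_eq_right.mpr ((Ideal.span_singleton_le_iff_mem I).mpr hy)]
  exact ⟨{y}, by simp⟩

theorem exists_eq_colon_singleton_of_mem_minimalPrimes {I q : Ideal A} [IsNoetherianRing (A ⧸ I)]
    (hq : q ∈ I.minimalPrimes) : ∃ d : A, q = Submodule.colon I {d} := by
  rw [Ideal.minimalPrimes_eq_comap] at hq
  obtain ⟨q', hq', rfl⟩ := hq
  have hann : (⊥ : Submodule (A ⧸ I) (A ⧸ I)).colon {1} = ⊥ := by
    ext x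
    simp [Submodule.mem_colon_singleton]
  obtain ⟨d', rfl⟩ := Submodule.exists_eq_colon_of_mem_minimalPrimes
    (show q' ∈ ((⊥ : Submodule (A ⧸ I) (A ⧸ I)).colon {1}).minimalPrimes by rwa [hann])
  obtain ⟨d, rfl⟩ := Ideal.Quotient.mk_surjective d'
  refine ⟨d, Ideal.ext fun a => ?_⟩
  simp [Submodule.mem_colon_singleton, ← map_mul, Ideal.Quotient.eq_zero_iff_mem]

theorem exists_isIntegral_notMem_one_of_comap_mem_minimalPrimes {b : B} {Q : Ideal B}
    [IsNoetherianRing (A ⧸ (1 : Submodule A B).colon {b})]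
    (hmin : Q.comap (algebraMap A B) ∈ ((1 : Submodule A B).colon {b}).minimalPrimes)
    (hfg : (Q.comap (algebraMap A B)).FG) {y : A} (hyQ : algebraMap A B y ∈ Q)
    (hy : algebraMap A B y ∈ nonZeroDivisors B) :
    ∃ c : B, IsIntegral A c ∧ c ∉ (1 : Submodule A B) ∧
      ∀ r : A, algebraMap A B r ∈ Q → r • c ∈ (1 : Submodule A B) := by
  obtain ⟨d, hd⟩ := exists_eq_colon_singleton_of_mem_minimalPrimes hmin
  have hmem (r : A) : algebraMap A B r ∈ Q ↔ r • d • b ∈ (1 : Submodule A B) := by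
    rw [← Ideal.mem_comap, hd, Submodule.mem_colon_singleton, smul_eq_mul,
      Submodule.mem_colon_singleton, mul_smul]
  refine ⟨d • b, ?_, fun h => hmin.1.1.ne_top ?_, fun r hr => (hmem r).mp hr⟩
  · -- Multiplication by `d • b` maps the image of `Q.comap (algebraMap A B)` into itself.
    refine isIntegral_of_forall_mul_mem (Submodule.FG.map (Algebra.linearMap A B) hfg)
      ⟨y, hyQ, rfl⟩ hy ?_
    rintro _ ⟨r, hr, rfl⟩
    obtain ⟨s, hs⟩ := Submodule.mem_one.mp ((hmem r).mp hr)
    have hsr : algebraMap A B s = d • b * algebraMap A B r := by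
      rw [hs, Algebra.smul_def, mul_comm]
    exact ⟨s, Ideal.mem_comap.mpr (hsr ▸ Q.mul_mem_left _ hr), hsr⟩
  · exact (Ideal.eq_top_iff_one _).mpr ((hmem 1).mpr (by rwa [one_smul]))

/-- The Nagata ideal transform of `D` in `B` with respect to `P`, consisting of the elements of `B`
that each element of `P` carries into `D` after finitely many multiplications. For finitely
generated `P` this says that some power of `P` does. -/
def idealTransform (P : Ideal A) (D : Subalgebra A B) : Subalgebra A B where
  carrier := {z | ∀ p ∈ P, ∃ k : ℕ, p ^ k • z ∈ D}
  mul_mem' {z w} hz hw p hp := by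
    obtain ⟨k, hk⟩ := hz p hp
    obtain ⟨l, hl⟩ := hw p hp
    exact ⟨k + l, by simpa only [pow_add, smul_mul_smul_comm] using mul_mem hk hl⟩
  add_mem' {z w} hz hw p hp := by
    obtain ⟨k, hk⟩ := hz p hp
    obtain ⟨l, hl⟩ := hw p hp
    refine ⟨l + k, ?_⟩
    rw [smul_add, pow_add, mul_smul, mul_comm, mul_smul]
    exact add_mem (D.smul_mem hk _) (D.smul_mem hl _)
  algebraMap_mem' a _ _ := ⟨0, by simp⟩

variable {P : Ideal A} {D : Subalgebra A B} {b : B}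

theorem mem_idealTransform : b ∈ idealTransform P D ↔ ∀ p ∈ P, ∃ k : ℕ, p ^ k • b ∈ D :=
  Iff.rfl

theorem mem_idealTransform_iff_le_radical :
    b ∈ idealTransform P D ↔ P ≤ ((Subalgebra.toSubmodule D).colon {b}).radical := by
  simp only [SetLike.le_def, Ideal.mem_radical_iff, Submodule.mem_colon_singleton,
    Subalgebra.mem_toSubmodule, mem_idealTransform]

theorem le_idealTransform : D ≤ idealTransform P D := fun z hz _ _ => ⟨0, by simpa using hz⟩

theorem mem_idealTransform_of_forall_smul_mem (h : ∀ p ∈ P, p • b ∈ idealTransform P D) :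
    b ∈ idealTransform P D := fun p hp => by
  obtain ⟨k, hk⟩ := h p hp p hp
  exact ⟨k + 1, by rwa [pow_succ, mul_smul]⟩

theorem exists_fg_le_integralClosure_mem_idealTransform (hP : P.FG)
    (hb : b ∈ idealTransform P (integralClosure A B)) :
    ∃ D ≤ integralClosure A B, (Subalgebra.toSubmodule D).FG ∧ b ∈ idealTransform P D := by
  obtain ⟨t, rfl⟩ := hP
  choose! k hk using fun p (hp : p ∈ t) => hb p (Ideal.subset_span hp)
  let S : Set B := (fun p => p ^ k p • b) '' t
  have hS : ∀ x ∈ S, IsIntegral A x := by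
    rintro _ ⟨p, hp, rfl⟩
    exact hk p hp
  refine ⟨Algebra.adjoin A S, Algebra.adjoin_le hS,
    fg_adjoin_of_finite (t.finite_toSet.image _) hS, ?_⟩
  exact mem_idealTransform_iff_le_radical.mpr <| Ideal.span_le.mpr fun p hp =>
    ⟨k p, Submodule.mem_colon_singleton.mpr (Algebra.subset_adjoin ⟨p, hp, rfl⟩)⟩

theorem isNoetherianRing_quotient_of_le_idealTransform [IsNoetherianRing A] [P.IsMaximal]
    {C : Subalgebra A B} (hDC : D ≤ C) (hCD : C ≤ idealTransform P D)
    (hD : (Subalgebra.toSubmodule D).FG) {y : A} (hyP : y ∈ P)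
    (hy : algebraMap A B y ∈ nonZeroDivisors B) {I : Ideal C} (hyI : algebraMap A C y ∈ I) :
    IsNoetherianRing (C ⧸ I) := by
  have : Module.Finite A D := Module.Finite.iff_fg.mpr hD
  have hreg : IsSMulRegular C y := fun z w hzw => by
    refine Subtype.ext (mul_cancel_left_mem_nonZeroDivisors hy |>.mp ?_)
    simpa [Algebra.smul_def] using congrArg Subtype.val hzw
  have := finite_quotient_of_forall_exists_pow_smul_mem
    (D := LinearMap.range (Subalgebra.inclusion hDC).toLinearMap)
    (Module.Finite.iff_fg.mp inferInstance)
    (fun p hp z => (hCD z.2 p hp).imp fun k hk => ⟨⟨_, hk⟩, rfl⟩) hyP hreg hyI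
  exact IsNoetherianRing.of_finite A (C ⧸ I)

theorem mem_minimalPrimes_of_isMaximal_comap [Algebra.IsIntegral A B] {I n : Ideal B}
    [n.IsPrime] [hmax : (n.comap (algebraMap A B)).IsMaximal] (hIn : I ≤ n)
    (hI : n.comap (algebraMap A B) ≤ I.radical.comap (algebraMap A B)) : n ∈ I.minimalPrimes := by
  refine ⟨⟨‹_›, hIn⟩, fun J ⟨hJ, hIJ⟩ hJn => ?_⟩
  have hle : n.comap (algebraMap A B) ≤ J.comap (algebraMap A B) :=
    hI.trans (Ideal.comap_mono (hJ.radical_le_iff.mpr hIJ))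
  have : (J.comap (algebraMap A B)).IsMaximal :=
    hmax.eq_of_le (hJ.comap _).ne_top hle ▸ hmax
  have := Ideal.isMaximal_of_isIntegral_of_isMaximal_comap J this
  exact (this.eq_of_le ‹n.IsPrime›.ne_top hJn).ge

theorem exists_mem_integralClosure_notMem_mul_mem_of_isMaximal [IsNoetherianRing A]
    (Q : Ideal B) [Q.IsPrime] [(Q.comap (algebraMap A B)).IsMaximal] {y : A}
    (hyQ : algebraMap A B y ∈ Q) (hy : algebraMap A B y ∈ nonZeroDivisors B)
    (hb : b ∈ idealTransform (Q.comap (algebraMap A B)) (integralClosure A B)) :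
    ∃ r ∈ integralClosure A B, r ∉ Q ∧ r * b ∈ integralClosure A B := by
  by_contra! hmem
  set P := Q.comap (algebraMap A B)
  obtain ⟨D, hD, hDfg, hbD⟩ :=
    exists_fg_le_integralClosure_mem_idealTransform (IsNoetherian.noetherian P) hb
  let C := idealTransform P D ⊓ integralClosure A B
  have hDC : D ≤ C := le_inf le_idealTransform hD
  have mem_one {x : B} : x ∈ (1 : Submodule C B) ↔ x ∈ C := by
    simp [Submodule.mem_one, Subalgebra.algebraMap_eq]
  have hint : Algebra.IsIntegral A C := le_integralClosure_iff_isIntegral.mp inf_le_right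
  let n := Q.comap (algebraMap C B)
  let I : Ideal C := (1 : Submodule C B).colon {b}
  have hIn : I ≤ n := fun r hr => by
    by_contra hrQ
    exact hmem r r.2.2 hrQ (mem_one.mp (Submodule.mem_colon_singleton.mp hr)).2
  have hbI {p : A} (hp : p ∈ P) : ∃ k : ℕ, algebraMap A C (p ^ k) ∈ I :=
    (hbD p hp).imp fun k hk => Submodule.mem_colon_singleton.mpr <|
      mem_one.mpr (by rw [algebraMap_smul]; exact hDC hk)
  have hmax : (n.comap (algebraMap A C)).IsMaximal := ‹P.IsMaximal›
  have hmin : n ∈ I.minimalPrimes := mem_minimalPrimes_of_isMaximal_comap (A := A) hIn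
    fun p hp => (hbI hp).imp fun k hk => by rwa [map_pow] at hk
  have : IsNoetherianRing (C ⧸ I) := by
    obtain ⟨k, hk⟩ := hbI hyQ
    exact isNoetherianRing_quotient_of_le_idealTransform hDC inf_le_left hDfg
      (hIn hk : y ^ k ∈ P) (by rw [map_pow]; exact pow_mem hy k) hk
  have : IsNoetherianRing (C ⧸ Ideal.span {algebraMap A C y}) :=
    isNoetherianRing_quotient_of_le_idealTransform hDC inf_le_left hDfg hyQ hy
      (Ideal.mem_span_singleton_self _)
  obtain ⟨c, hc, hcC, hQc⟩ := exists_isIntegral_notMem_one_of_comap_mem_minimalPrimes hmin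
    (fg_of_mem_of_isNoetherianRing_quotient_span (y := algebraMap A C y) hyQ)
    (y := algebraMap A C y) hyQ hy
  refine hcC (mem_one.mpr
    ⟨mem_idealTransform_of_forall_smul_mem fun p hp => ?_, isIntegral_trans c hc⟩)
  rw [← algebraMap_smul C p c]
  exact (mem_one.mp (hQc (algebraMap A C p) hp)).1

section Localization

variable (M : Submonoid A) {A' B' : Type*} [CommRing A'] [CommRing B'] [Algebra A A']
  [Algebra B B'] [Algebra A' B'] [Algebra A B'] [IsScalarTower A A' B'] [IsScalarTower A B B']
  [IsLocalization M A'] [IsLocalization (Algebra.algebraMapSubmonoid B M) B']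

theorem exists_smul_isIntegral_of_isIntegral_algebraMap
    (h : IsIntegral A' (algebraMap B B' b)) : ∃ m ∈ M, IsIntegral A (m • b) := by
  obtain ⟨m, hm⟩ := h.exists_multiple_integral_of_isLocalization M
  obtain ⟨m', hm', hmm'⟩ := IsLocalization.exists_isIntegral_smul_of_isIntegral_map M
    (Sₘ := B') (x := (m : A) • b) (by rwa [← IsScalarTower.toAlgHom_apply A, map_smul])
  exact ⟨m' * m, mul_mem hm' m.2, by rwa [mul_smul]⟩

theorem exists_mem_integralClosure_notMem_mul_mem_of_isLocalization {Q : Ideal B} [Q.IsPrime]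
    (hQ : ∀ m ∈ M, algebraMap A B m ∉ Q) {r' : B'} (hr' : IsIntegral A' r')
    (hr'Q : r' ∉ Q.map (algebraMap B B')) (hr'b : IsIntegral A' (r' * algebraMap B B' b)) :
    ∃ r ∈ integralClosure A B, r ∉ Q ∧ r * b ∈ integralClosure A B := by
  obtain ⟨⟨r, _, s, hs, rfl⟩, hrs⟩ := IsLocalization.surj (Algebra.algebraMapSubmonoid B M) r'
  have hr : algebraMap B B' r = algebraMap A A' s • r' := by
    rw [← hrs, algebraMap_smul, Algebra.smul_def, mul_comm, ← IsScalarTower.algebraMap_apply]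
  have hrQ : r ∉ Q := fun h => hr'Q <| by
    obtain ⟨u, hu⟩ := IsLocalization.map_units A' ⟨s, hs⟩
    have hr' : r' = (↑u⁻¹ : A') • algebraMap B B' r := by
      rw [hr, ← hu, ← Units.smul_def, ← Units.smul_def, inv_smul_smul]
    rw [hr', Algebra.smul_def]
    exact Ideal.mul_mem_left _ _ (Ideal.mem_map_of_mem _ h)
  obtain ⟨m₁, hm₁, h₁⟩ := exists_smul_isIntegral_of_isIntegral_algebraMap M (b := r)
    (hr ▸ hr'.smul _)
  obtain ⟨m₂, hm₂, h₂⟩ := exists_smul_isIntegral_of_isIntegral_algebraMap M (B' := B')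
    (b := r * b) (by rw [map_mul, hr, smul_mul_assoc]; exact hr'b.smul _)
  refine ⟨(m₂ * m₁) • r, mul_smul m₂ m₁ r ▸ h₁.smul m₂, ?_, ?_⟩
  · rw [Algebra.smul_def]
    exact fun h => (Ideal.IsPrime.mem_or_mem ‹_› h).elim (hQ _ (mul_mem hm₂ hm₁)) hrQ
  · rw [mul_comm m₂, mul_smul, smul_mul_assoc, smul_mul_assoc]
    exact h₂.smul m₁

end Localization

theorem exists_notMem_le_radical_colon_of_mem_minimalPrimes {I q : Ideal A}
    (hq : q ∈ I.minimalPrimes) {J : Ideal A} (hJ : J.FG) (hJq : J ≤ q) :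
    ∃ s ∉ q, J ≤ (Submodule.colon I {s}).radical := by
  have := hq.1.1
  have hmem (p : A) (hp : p ∈ q) : ∃ s ∉ q, p ∈ (Submodule.colon I {s}).radical := by
    obtain ⟨k, hk⟩ := (IsLocalization.AtPrime.radical_map_of_mem_minimalPrimes
      (Localization.AtPrime q) q I hq).ge (Ideal.mem_map_of_mem _ hp)
    rw [← map_pow, IsLocalization.algebraMap_mem_map_algebraMap_iff q.primeCompl] at hk
    obtain ⟨s, hs, hsp⟩ := hk
    exact ⟨s, hs, k, Submodule.mem_colon_singleton.mpr (by rwa [smul_eq_mul, mul_comm])⟩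
  induction J, hJ using Submodule.fg_induction with
  | singleton p =>
    obtain ⟨s, hs, hps⟩ := hmem p (hJq (Submodule.mem_span_singleton_self p))
    exact ⟨s, hs, (Ideal.span_singleton_le_iff_mem _).mpr hps⟩
  | sup J₁ J₂ _ _ h₁ h₂ =>
    have hmono (r s : A) : Submodule.colon I {s} ≤ Submodule.colon I {r * s} := fun a ha => by
      rw [Submodule.mem_colon_singleton] at ha ⊢
      rw [smul_eq_mul, mul_left_comm]
      exact I.mul_mem_left r ha
    obtain ⟨s₁, hs₁, hJ₁⟩ := h₁ (le_sup_left.trans hJq)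
    obtain ⟨s₂, hs₂, hJ₂⟩ := h₂ (le_sup_right.trans hJq)
    exact ⟨s₂ * s₁, q.primeCompl.mul_mem hs₂ hs₁, sup_le
      (hJ₁.trans (Ideal.radical_mono (hmono s₂ s₁)))
      (hJ₂.trans (Ideal.radical_mono (mul_comm s₂ s₁ ▸ hmono s₁ s₂)))⟩

theorem exists_mem_integralClosure_notMem_mul_mem [IsNoetherianRing A] (Q : Ideal B) [Q.IsPrime]
    {y : A} (hyQ : algebraMap A B y ∈ Q) (hy : algebraMap A B y ∈ nonZeroDivisors B)
    (hb : b ∈ idealTransform (Q.comap (algebraMap A B)) (integralClosure A B)) :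
    ∃ r ∈ integralClosure A B, r ∉ Q ∧ r * b ∈ integralClosure A B := by
  let P := Q.comap (algebraMap A B)
  have hQ : Q.LiesOver P := ⟨rfl⟩
  let A' := Localization.AtPrime P
  let M := Algebra.algebraMapSubmonoid B P.primeCompl
  let B' := Localization M
  have : IsNoetherianRing A' := IsLocalization.isNoetherianRing P.primeCompl A' inferInstance
  let Q' := Q.map (algebraMap B B')
  have : Q'.IsPrime := IsLocalization.AtPrime.isPrime_map_of_liesOver B P B' Q
  have hQ'P : Q'.comap (algebraMap A' B') = IsLocalRing.maximalIdeal A' :=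
    (IsLocalization.AtPrime.liesOver_map_of_liesOver P A' B' Q).over.symm
  have : (Q'.comap (algebraMap A' B')).IsMaximal := hQ'P ▸ inferInstance
  have hmap (x : A) :
      algebraMap A' B' (algebraMap A A' x) = algebraMap B B' (algebraMap A B x) := by
    rw [← IsScalarTower.algebraMap_apply, ← IsScalarTower.algebraMap_apply]
  have hb' : algebraMap B B' b ∈
      idealTransform (Q'.comap (algebraMap A' B')) (integralClosure A' B') := by
    rw [hQ'P, mem_idealTransform_iff_le_radical, ← Localization.AtPrime.map_eq_maximalIdeal,
      Ideal.map_le_iff_le_comap]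
    intro p hp
    obtain ⟨k, hk⟩ := hb p hp
    refine ⟨k, Submodule.mem_colon_singleton.mpr ?_⟩
    rw [Algebra.smul_def, map_pow, hmap, ← map_pow, ← map_pow, ← map_mul, ← Algebra.smul_def]
    exact (IsIntegral.algebraMap hk).tower_top
  obtain ⟨r', hr', hr'Q, hr'b⟩ := exists_mem_integralClosure_notMem_mul_mem_of_isMaximal Q'
    (hmap y ▸ Ideal.mem_map_of_mem _ hyQ)
    (hmap y ▸ IsLocalization.nonZeroDivisors_le_comap M B' hy) hb'
  exact exists_mem_integralClosure_notMem_mul_mem_of_isLocalization P.primeCompl (fun _ hs => hs)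
    hr' hr'Q hr'b

end

section

variable {A R B : Type*} [CommRing A] [CommRing R] [CommRing B]
  [Algebra A R] [Algebra R B] [Algebra A B] [IsScalarTower A R B]

theorem comap_algebraMap_notMem_minimalPrimes_colon_singleton [IsNoetherianRing A]
    [IsIntegralClosure R A B] (Q : Ideal B) [Q.IsPrime] {b : B} {y : A}
    (hy : algebraMap A B y ∈ nonZeroDivisors B) (hyb : IsIntegral A (y • b)) :
    Q.comap (algebraMap R B) ∉ ((1 : Submodule R B).colon {b}).minimalPrimes := by
  intro hq
  have mem_colon (x : B) {r : R} :
      r ∈ (1 : Submodule R B).colon {x} ↔ algebraMap R B r * x ∈ integralClosure A B := by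
    rw [Submodule.mem_colon_singleton, Submodule.mem_one, Algebra.smul_def]
    exact (IsIntegralClosure.isIntegral_iff (A := R)).symm
  have hyQ : algebraMap A B y ∈ Q := by
    rw [IsScalarTower.algebraMap_apply A R B]
    refine hq.1.2 ((mem_colon b).mpr ?_)
    rwa [← IsScalarTower.algebraMap_apply, ← Algebra.smul_def]
  let P := Q.comap (algebraMap A B)
  obtain ⟨s, hsQ, hs⟩ := exists_notMem_le_radical_colon_of_mem_minimalPrimes hq
    (J := P.map (algebraMap A R)) (Ideal.FG.map (IsNoetherian.noetherian P) _) <|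
    Ideal.map_le_iff_le_comap.mpr fun p hp => by
      rwa [Ideal.mem_comap, Ideal.mem_comap, ← IsScalarTower.algebraMap_apply]
  have hsb : algebraMap R B s * b ∈ idealTransform P (integralClosure A B) := fun p hp => by
    obtain ⟨k, hk⟩ := hs (Ideal.mem_map_of_mem _ hp)
    refine ⟨k, ?_⟩
    have := (mem_colon b).mp (Submodule.mem_colon_singleton.mp hk)
    rwa [smul_eq_mul, map_mul, mul_assoc, ← map_pow, ← IsScalarTower.algebraMap_apply,
      ← Algebra.smul_def] at this
  obtain ⟨_, hr, hrQ, hrsb⟩ := exists_mem_integralClosure_notMem_mul_mem Q hyQ hy hsb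
  obtain ⟨r, rfl⟩ := (IsIntegralClosure.isIntegral_iff (A := R)).mp hr
  refine (hq.1.1.mem_or_mem (hq.1.2 ((mem_colon b (r := r * s)).mpr ?_))).elim hrQ hsQ
  rwa [map_mul, mul_assoc]

theorem flat_of_forall_map_colon_singleton_eq_top (hRB : Function.Injective (algebraMap R B))
    (h : ∀ b : B, ((1 : Submodule R B).colon {b}).map (algebraMap R B) = ⊤) : Module.Flat R B := by
  refine Module.Flat.of_forall_isTrivialRelation fun {l f x} hfx => ?_
  let J : Ideal R := ∏ i, (1 : Submodule R B).colon {x i}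
  have hJ : J.map (algebraMap R B) = ⊤ := by
    rw [← Ideal.mapHom_apply, map_prod, ← Ideal.one_eq_top]
    exact Finset.prod_eq_one fun i _ => (h (x i)).trans Ideal.one_eq_top.symm
  obtain ⟨k, c, u, hcu⟩ := Submodule.mem_span_set'.mp ((Ideal.eq_top_iff_one _).mp hJ)
  choose v hv hvu using fun j => (u j).2
  have hvx (i j) : ∃ a : R, algebraMap R B a = v j • x i :=
    Submodule.mem_one.mp <| Submodule.mem_colon_singleton.mp <|
      Ideal.prod_le_inf.trans (Finset.inf_le (Finset.mem_univ i)) (hv j)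
  choose a ha using hvx
  refine ⟨k, a, c, fun i => ?_, fun j => hRB ?_⟩
  · simp only [Algebra.smul_def, ha]
    calc
      x i = x i * ∑ j, c j • (u j : B) := by rw [hcu, mul_one]
      _ = _ := ?_
    simp only [Finset.mul_sum, ← hvu, smul_eq_mul]
    exact Finset.sum_congr rfl fun j _ => by ring
  · simp only [map_sum, map_mul, ha, map_zero, mul_smul_comm, ← Algebra.smul_def,
      ← Finset.smul_sum, hfx, smul_zero]

theorem flat_of_hasGoingDown_of_isIntegralClosure [IsNoetherianRing A] [IsIntegralClosure R A B]
    [Algebra.HasGoingDown R B]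
    (hB : ∀ b : B, ∃ y : A, algebraMap A B y ∈ nonZeroDivisors B ∧ IsIntegral A (y • b)) :
    Module.Flat R B := by
  refine flat_of_forall_map_colon_singleton_eq_top
    (IsIntegralClosure.algebraMap_injective R A B) fun b => ?_
  by_contra hne
  obtain ⟨y, hy, hyb⟩ := hB b
  obtain ⟨Q, hQ, hbQ⟩ := Ideal.exists_le_maximal _ hne
  obtain ⟨q, hq, hqQ⟩ := Ideal.exists_minimalPrimes_le (Ideal.map_le_iff_le_comap.mp hbQ)
  have := hq.1.1
  have : Q.LiesOver (Q.comap (algebraMap R B)) := ⟨rfl⟩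
  obtain ⟨Q', -, hQ', hQ'q⟩ := Ideal.exists_ideal_le_liesOver_of_le (p := q) Q hqQ
  exact comap_algebraMap_notMem_minimalPrimes_colon_singleton Q' hy hyb (hQ'q.over ▸ hq)

end

theorem isFractionRing_of_isScalarTower (A S K : Type*) [CommRing A] [CommRing S] [CommRing K]
    [Algebra A S] [Algebra A K] [Algebra S K] [IsScalarTower A S K] [IsFractionRing A K]
    [FaithfulSMul S K] : IsFractionRing S K := by
  have hinj := FaithfulSMul.algebraMap_injective S K
  have hmap (s : A) : algebraMap S K (algebraMap A S s) = algebraMap A K s :=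
    (IsScalarTower.algebraMap_apply A S K s).symm
  refine ⟨fun r => ?_, fun z => ?_, fun h => ⟨1, by rw [hinj h]⟩⟩
  · have hr : algebraMap S K r ∈ nonZeroDivisors K :=
      mem_nonZeroDivisors_iff_right.mpr fun z hz => by
        obtain ⟨⟨a, s⟩, has⟩ := IsLocalization.surj (nonZeroDivisors A) z
        have ha : algebraMap A S a = 0 := mem_nonZeroDivisors_iff_right.mp r.2 _ <| hinj <| by
          rw [map_mul, hmap, ← has, mul_right_comm, hz, zero_mul, map_zero]
        rwa [← hmap a, ha, map_zero, (IsLocalization.map_units K s).mul_left_eq_zero] at has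
    rwa [IsFractionRing.nonZeroDivisors_eq_isUnit A K] at hr
  · obtain ⟨⟨a, s⟩, has⟩ := IsLocalization.surj (nonZeroDivisors A) z
    refine ⟨⟨algebraMap A S a, algebraMap A S s, ?_⟩, by simpa only [hmap] using has⟩
    refine mem_nonZeroDivisors_of_injective hinj (hmap s ▸ ?_)
    exact (IsLocalization.map_units K s).mem_nonZeroDivisors

theorem isIntegralClosure_of_injective {A R B K : Type*} [CommRing A] [CommRing R]
    [CommRing B] [CommRing K] [Algebra A R] [Algebra A B] [Algebra A K] [Algebra R B] [Algebra R K]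
    [IsScalarTower A R B] [IsScalarTower A R K] [IsIntegralClosure R A K]
    (f : B →ₐ[R] K) (hf : Function.Injective f) : IsIntegralClosure R A B where
  algebraMap_injective := Function.Injective.of_comp (f := f) <| by
    simpa only [← RingHom.coe_coe f, ← RingHom.coe_comp, f.comp_algebraMap] using
      IsIntegralClosure.algebraMap_injective R A K
  isIntegral_iff {x} := by
    rw [← isIntegral_algHom_iff (f.restrictScalars A) hf, AlgHom.restrictScalars_apply,
      IsIntegralClosure.isIntegral_iff (A := R)]
    simp only [← f.commutes, hf.eq_iff]

theorem exists_smul_eq_algebraMap_of_injective {A B K : Type*} [CommRing A] [CommRing B]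
    [CommRing K] [Algebra A B] [Algebra A K] [IsFractionRing A K] (f : B →ₐ[A] K)
    (hf : Function.Injective f) (b : B) :
    ∃ s a : A, algebraMap A B s ∈ nonZeroDivisors B ∧ s • b = algebraMap A B a := by
  obtain ⟨⟨a, s⟩, has⟩ := IsLocalization.surj (nonZeroDivisors A) (f b)
  refine ⟨s, a, mem_nonZeroDivisors_of_injective hf ?_, hf ?_⟩
  · rw [f.commutes]
    exact (IsLocalization.map_units K s).mem_nonZeroDivisors
  · rw [map_smul, f.commutes, Algebra.smul_def, mul_comm, has]

theorem corollary27_general (A : Type*) [CommRing A] [IsNoetherianRing A]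
    (K : Type*) [CommRing K] [Algebra A K] [IsFractionRing A K] :
    IsPerinormal (integralClosure A K) := by
  intro B hB
  have := isFractionRing_of_isScalarTower A (integralClosure A K) K
  let f : B →ₐ[integralClosure A K] K :=
    (FractionRing.algEquiv (integralClosure A K) K).toAlgHom.comp B.val
  have hf : Function.Injective f :=
    (FractionRing.algEquiv (integralClosure A K) K).injective.comp Subtype.val_injective
  have := isIntegralClosure_of_injective (A := A) f hf
  refine flat_of_hasGoingDown_of_isIntegralClosure (A := A) fun b => ?_
  obtain ⟨s, a, hs, hsb⟩ := exists_smul_eq_algebraMap_of_injective (f.restrictScalars A) hf b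
  exact ⟨s, hs, hsb ▸ isIntegral_algebraMap⟩

theorem corollary27 (A : Type*) [CommRing A] [IsReduced A] [IsNoetherianRing A]
    (K : Type*) [CommRing K] [Algebra A K] [IsFractionRing A K] :
    IsPerinormal (integralClosure A K) :=
  corollary27_general A K
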